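/- **Theorem 2.** For $n\ge 3$ let $P_n\subset\mathbb{R}^2$ be the regular $n$-gon with vertices $(\cos\frac{2k\pi}{n},\sin\frac{2k\pi}{n})$, $k=0,\dots,n-1$. For convex bodies $C,D\subset\mathbb{R}^d$ that are symmetric about the origin let $$\delta_{BM}(C,D)=\inf\{\lambda>0:\ a(C)\subset D\subset\lambda\, a(C)\ \text{for some invertible affine map } a:\mathbb{R}^d\to\mathbb{R}^d\}$$ be their Banach-Mazur distance, where $\lambda X=\{\lambda x:x\in X\}$. Then (I) $\delta_{BM}(P_4,P_{8j})=\sqrt2$ for every integer $j\ge1$; (II) $\delta_{BM}(P_4,P_{8j+2})\le\frac12\sec\frac{2j\pi}{8j+2}+\cos\frac{2j\pi}{8j+2}$ for every integer $j\ge1$; (III) $\delta_{BM}(P_4,P_{8j+4})=\sqrt2\,\cos\frac{\pi}{8j+4}$ for every integer $j\ge0$; (IV) $\delta_{BM}(P_4,P_{8j+6})\le\sin\frac{(2j+2)\pi}{8j+6}\cdot\csc\frac{(4j+2)\pi}{8j+6}+\cos\frac{(2j+2)\pi}{8j+6}$ for every integer $j\ge0$. -/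

import Mathlib

open scoped Pointwise

/-- The regular `n`-gon `P_n` in the Euclidean plane: the convex hull of the points
`(cos (2kπ/n), sin (2kπ/n))`, `k = 0, …, n - 1`. -/
def regularPolygon (n : ℕ) : Set (EuclideanSpace ℝ (Fin 2)) :=
  convexHull ℝ (Set.range fun k : Fin n =>
    !₂[Real.cos (2 * (k : ℝ) / (n : ℝ) * Real.pi), Real.sin (2 * (k : ℝ) / (n : ℝ) * Real.pi)])

/-- The positive ratios `r` for which some affine transformation `a` of `ℝ^d` satisfies
`a(C) ⊆ D ⊆ r a(C)`, where `r a(C)` is the image of `a(C)` under the homothety with ratio `r`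
centered at the origin. -/
def bmRatios {d : ℕ} (C D : Set (EuclideanSpace ℝ (Fin d))) : Set ℝ :=
  {r | 0 < r ∧ ∃ a : EuclideanSpace ℝ (Fin d) ≃ᵃ[ℝ] EuclideanSpace ℝ (Fin d),
    a '' C ⊆ D ∧ D ⊆ r • (a '' C)}

/-- The Banach-Mazur distance of two convex bodies `C`, `D` of `ℝ^d` that are symmetric about the
origin: the infimum of the ratios `r` with `a(C) ⊆ D ⊆ r a(C)` for some affine transformation `a`.
The infimum is taken in the extended reals, so that it would be `⊤` if there were no such `r`. -/
noncomputable def bmDist {d : ℕ} (C D : Set (EuclideanSpace ℝ (Fin d))) : EReal :=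
  ⨅ r ∈ bmRatios C D, (r : EReal)

/-! A linear image of the square is a parallelogram with vertices ±u, ±v. If D = det(u, v) > 0, a
point x lies in its r-fold dilate exactly when |det(u - v, x)| ≤ rD and |det(u + v, x)| ≤ rD. This
turns upper bounds into a choice of u, v in the polygon (`bmDist_four_le`), and lower bounds into
testing the inequalities at well-chosen points (`exists_columns_of_mem_bmRatios`).

Lower bounds: for n = 8j the test points are ±u, ±v rotated by odd multiples of π/4; for n = 8j + 4
the inscribed disc of radius cos(π/n) bounds the support function from below. Both end with 2D ≤
|u|² + |v|².

Upper bounds: if 4 ∣ n, the square with vertices (±1, 0), (0, ±1) is inscribed. If n ≡ 2 mod 4, the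
bounding box of the polygon is shrunk until its corners lie on edges; (II) and (IV) are the same
computation with different φ. -/

open Real in
/-- The vertex of the regular `n`-gon with index `k`, for an arbitrary integer `k`. -/
noncomputable def polygonVertex (n : ℕ) (k : ℤ) : EuclideanSpace ℝ (Fin 2) :=
  !₂[cos (2 * (k : ℝ) / (n : ℝ) * π), sin (2 * (k : ℝ) / (n : ℝ) * π)]

/-- The determinant of two plane vectors. -/
def planeCross (u v : EuclideanSpace ℝ (Fin 2)) : ℝ := u 0 * v 1 - u 1 * v 0

/-! ### Regular polygons, central symmetry and the square -/

theorem polygonVertex_mem {n : ℕ} (hn : n ≠ 0) (k : ℤ) :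
    polygonVertex n k ∈ regularPolygon n := by
  apply subset_convexHull
  have hn' : (n : ℤ) ≠ 0 := by exact_mod_cast hn
  have hnR : (n : ℝ) ≠ 0 := by exact_mod_cast hn
  have h0 := Int.emod_nonneg k hn'
  have h1 : k % n < n := Int.emod_lt_of_pos k (by positivity)
  refine ⟨⟨(k % n).toNat, by omega⟩, ?_⟩
  have hc : (((k % n).toNat : ℕ) : ℝ) = ((k % n : ℤ) : ℝ) := by
    exact_mod_cast congrArg (Int.cast (R := ℝ)) (Int.toNat_of_nonneg h0)
  have hk : (k : ℝ) = ((k % n : ℤ) : ℝ) + n * ((k / n : ℤ) : ℝ) := by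
    exact_mod_cast (Int.emod_add_mul_ediv k n).symm
  have ha : 2 * (k : ℝ) / n * Real.pi
      = 2 * ((k % n : ℤ) : ℝ) / n * Real.pi + ((k / n : ℤ) : ℝ) * (2 * Real.pi) := by
    rw [hk]; field_simp
  simp only [polygonVertex, hc, ha, Real.cos_add_int_mul_two_pi, Real.sin_add_int_mul_two_pi]

theorem regularPolygon_subset {n : ℕ} {s : Set (EuclideanSpace ℝ (Fin 2))} (hs : Convex ℝ s)
    (h : ∀ k : ℤ, polygonVertex n k ∈ s) : regularPolygon n ⊆ s := by
  apply convexHull_min _ hs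
  rintro _ ⟨k, rfl⟩
  simpa only [polygonVertex, Int.cast_natCast] using h (k : ℕ)

theorem convex_regularPolygon (n : ℕ) : Convex ℝ (regularPolygon n) := convex_convexHull ℝ _

theorem neg_mem_regularPolygon {n : ℕ} (hn : n ≠ 0) (he : Even n)
    {x : EuclideanSpace ℝ (Fin 2)} (hx : x ∈ regularPolygon n) : -x ∈ regularPolygon n := by
  obtain ⟨m, hm⟩ := he
  have hnR : (n : ℝ) ≠ 0 := by exact_mod_cast hn
  have hsub : regularPolygon n ⊆ -regularPolygon n := by
    refine regularPolygon_subset (convex_regularPolygon n).neg fun k => ?_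
    have hv : -polygonVertex n k = polygonVertex n (k + m) := by
      have ha : 2 * ((k + m : ℤ) : ℝ) / n * Real.pi = 2 * (k : ℝ) / n * Real.pi + Real.pi := by
        have : (n : ℝ) = m + m := by exact_mod_cast hm
        push_cast
        field_simp
        rw [this]; ring
      ext i
      fin_cases i <;> simp [-Int.cast_add, polygonVertex, ha, Real.cos_add_pi, Real.sin_add_pi]
    rw [Set.mem_neg, hv]
    exact polygonVertex_mem hn _
  exact hsub hx

theorem sq_add_sq_le_one_of_mem_regularPolygon {n : ℕ} {x : EuclideanSpace ℝ (Fin 2)}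
    (hx : x ∈ regularPolygon n) : x 0 ^ 2 + x 1 ^ 2 ≤ 1 := by
  have h : regularPolygon n ⊆ Metric.closedBall 0 1 := by
    refine regularPolygon_subset (convex_closedBall _ _) fun k => ?_
    simp [EuclideanSpace.norm_eq, polygonVertex, Fin.sum_univ_two]
  have := h hx
  rw [mem_closedBall_zero_iff, EuclideanSpace.norm_eq, Real.sqrt_le_one] at this
  simpa [Fin.sum_univ_two] using this

theorem mem_regularPolygon_four_iff {x : EuclideanSpace ℝ (Fin 2)} :
    x ∈ regularPolygon 4 ↔ |x 0 + x 1| ≤ 1 ∧ |x 0 - x 1| ≤ 1 := by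
  have c0 : polygonVertex 4 0 = !₂[1, 0] := by simp [polygonVertex]
  have c1 : polygonVertex 4 1 = !₂[0, 1] := by
    have : 2 * ((1 : ℤ) : ℝ) / ((4 : ℕ) : ℝ) * Real.pi = Real.pi / 2 := by push_cast; ring
    simp only [polygonVertex, this, Real.cos_pi_div_two, Real.sin_pi_div_two]
  have h0 : !₂[1, 0] ∈ regularPolygon 4 := c0 ▸ polygonVertex_mem (by norm_num) 0
  have h1 : !₂[0, 1] ∈ regularPolygon 4 := c1 ▸ polygonVertex_mem (by norm_num) 1
  have h2 := neg_mem_regularPolygon (by norm_num) (by decide) h0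
  have h3 := neg_mem_regularPolygon (by norm_num) (by decide) h1
  constructor
  · intro hx
    have hsub : regularPolygon 4 ⊆ {x | |x 0 + x 1| ≤ 1 ∧ |x 0 - x 1| ≤ 1} := by
      apply convexHull_min
      · rintro _ ⟨k, rfl⟩
        have e2 : (2 * 2 / 4 * Real.pi : ℝ) = Real.pi := by ring
        have e1 : (2 / 4 * Real.pi : ℝ) = Real.pi / 2 := by ring
        have e3 : (2 * 3 / 4 * Real.pi : ℝ) = Real.pi / 2 + Real.pi := by ring
        fin_cases k <;> simp [e1, e2, e3, Real.cos_add_pi, Real.sin_add_pi]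
      · intro y hy z hz a b ha hb hab
        simp only [Set.mem_ofPred_eq, abs_le, PiLp.add_apply, PiLp.smul_apply,
          smul_eq_mul] at hy hz ⊢
        obtain ⟨⟨_, _⟩, _, _⟩ := hy
        obtain ⟨⟨_, _⟩, _, _⟩ := hz
        obtain rfl : b = 1 - a := by linarith
        refine ⟨⟨?_, ?_⟩, ?_, ?_⟩ <;> nlinarith
    exact hsub hx
  · rintro ⟨hp, hm⟩
    rw [abs_le] at hp hm
    -- The square is a product of two segments in the coordinates x 0 + x 1 and x 0 - x 1; `s` and
    -- `t` are these coordinates rescaled to [0, 1].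
    set s : ℝ := (1 + (x 0 + x 1)) / 2 with hs
    set t : ℝ := (1 + (x 0 - x 1)) / 2 with ht
    have ha := (convex_regularPolygon 4) h0 h1 (a := t) (b := 1 - t)
      (by linarith) (by linarith) (by ring)
    have hb := (convex_regularPolygon 4) h3 h2 (a := t) (b := 1 - t)
      (by linarith) (by linarith) (by ring)
    have hc := (convex_regularPolygon 4) ha hb (a := s) (b := 1 - s)
      (by linarith) (by linarith) (by ring)
    convert hc using 1
    ext i
    fin_cases i <;> simp <;> rw [hs, ht] <;> ring

/-! ### Parallelograms and admissible ratios -/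

/-- The linear automorphism of the plane with columns `u` and `v`. -/
noncomputable def planeEquivOfColumns (u v : EuclideanSpace ℝ (Fin 2)) (h : planeCross u v ≠ 0) :
    EuclideanSpace ℝ (Fin 2) ≃ₗ[ℝ] EuclideanSpace ℝ (Fin 2) where
  toFun z := z 0 • u + z 1 • v
  invFun w := !₂[planeCross w v / planeCross u v, planeCross u w / planeCross u v]
  map_add' y z := by
    ext i; simp; ring
  map_smul' c z := by
    ext i; simp; ring
  left_inv z := by
    ext i
    fin_cases i
    · simp only [Fin.zero_eta, Matrix.cons_val_zero]
      rw [div_eq_iff h]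
      simp [planeCross]; ring
    · simp only [Fin.mk_one, Matrix.cons_val_one, Matrix.cons_val_fin_one]
      rw [div_eq_iff h]
      simp [planeCross]; ring
  right_inv w := by
    ext i
    simp only [PiLp.add_apply, PiLp.smul_apply, smul_eq_mul,
      Matrix.cons_val_zero, Matrix.cons_val_one, Matrix.cons_val_fin_one]
    field_simp
    fin_cases i <;> simp [planeCross] <;> ring

/-- For w = αu + βv the two determinants are (α + β)D and (β - α)D, so the bounds place w in the
r-fold parallelogram; by convexity vertices suffice. -/
theorem bmDist_four_le {n : ℕ} (hn : n ≠ 0) (he : Even n) {u v : EuclideanSpace ℝ (Fin 2)}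
    {r : ℝ} (hr : 0 < r) (hu : u ∈ regularPolygon n) (hv : v ∈ regularPolygon n)
    (hD : 0 < planeCross u v)
    (hm : ∀ k : ℤ, |planeCross (u - v) (polygonVertex n k)| ≤ r * planeCross u v)
    (hp : ∀ k : ℤ, |planeCross (u + v) (polygonVertex n k)| ≤ r * planeCross u v) :
    bmDist (regularPolygon 4) (regularPolygon n) ≤ (r : EReal) := by
  have hmem : r ∈ bmRatios (regularPolygon 4) (regularPolygon n) := by
    set L := planeEquivOfColumns u v hD.ne'
    have hconv : Convex ℝ (L '' regularPolygon 4) :=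
      (convex_regularPolygon 4).linear_image L.toLinearMap
    have hK := convex_regularPolygon n
    refine ⟨hr, L.toAffineEquiv, ?_, ?_⟩
    · have hsub : regularPolygon 4 ⊆ L ⁻¹' regularPolygon n := by
        apply convexHull_min
        · have hun := neg_mem_regularPolygon hn he hu
          have hvn := neg_mem_regularPolygon hn he hv
          rintro _ ⟨k, rfl⟩
          have e2 : (2 * 2 / 4 * Real.pi : ℝ) = Real.pi := by ring
          have e1 : (2 / 4 * Real.pi : ℝ) = Real.pi / 2 := by ring
          have e3 : (2 * 3 / 4 * Real.pi : ℝ) = Real.pi / 2 + Real.pi := by ring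
          fin_cases k <;> simpa [L, planeEquivOfColumns, e1, e2, e3, Real.cos_add_pi,
            Real.sin_add_pi]
        · exact hK.linear_preimage L.toLinearMap
      rintro _ ⟨z, hz, rfl⟩
      exact hsub hz
    · refine regularPolygon_subset (hconv.smul r) fun k => ?_
      set w := polygonVertex n k
      refine (Set.mem_smul_set_iff_inv_smul_mem₀ hr.ne' _ _).2 ⟨L.symm (r⁻¹ • w), ?_, by simp⟩
      rw [mem_regularPolygon_four_iff]
      have h1 := hm k
      have h2 := hp k
      have key : ∀ {c : ℝ}, |c| ≤ r * planeCross u v → |c / (r * planeCross u v)| ≤ 1 := by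
        intro c hc
        rwa [abs_div, abs_of_pos (mul_pos hr hD), div_le_one (mul_pos hr hD)]
      have s0 : L.symm (r⁻¹ • w) 0 = planeCross w v / (r * planeCross u v) := by
        simp only [map_smul, PiLp.smul_apply, smul_eq_mul]
        change r⁻¹ * (planeCross w v / planeCross u v) = _
        field_simp
      have s1 : L.symm (r⁻¹ • w) 1 = planeCross u w / (r * planeCross u v) := by
        simp only [map_smul, PiLp.smul_apply, smul_eq_mul]
        change r⁻¹ * (planeCross u w / planeCross u v) = _
        field_simp
      rw [s0, s1, ← add_div, ← sub_div]
      constructor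
      · apply key
        convert h1 using 2
        simp [planeCross, w]; ring
      · apply key
        rw [← abs_neg]
        convert h2 using 2
        simp [planeCross, w]; ring
  exact iInf₂_le r hmem

/-- The parallelogram `a(P₄)`, symmetrized about the origin, has vertices `±u`, `±v`. -/
theorem exists_columns_of_mem_bmRatios {n : ℕ} (hn : n ≠ 0) (he : Even n) {r : ℝ}
    (hr : r ∈ bmRatios (regularPolygon 4) (regularPolygon n)) :
    ∃ u ∈ regularPolygon n, ∃ v ∈ regularPolygon n, 0 ≤ planeCross u v ∧ u ≠ 0 ∧
      (∀ x ∈ regularPolygon n, planeCross (u - v) x ≤ r * planeCross u v) ∧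
      (∀ x ∈ regularPolygon n, planeCross (u + v) x ≤ r * planeCross u v) := by
  obtain ⟨hr0, a, hin, hout⟩ := hr
  have hdecomp : ∀ z, a z = a.linear z + a 0 := fun z => by
    simpa only [vadd_eq_add, add_zero] using a.map_vadd 0 z
  have hneg : ∀ {z}, z ∈ regularPolygon 4 → -z ∈ regularPolygon 4 := fun hz =>
    neg_mem_regularPolygon (by norm_num) (by decide) hz
  -- The translation part cancels in the average of a(z) and -a(-z), so by symmetry both inclusions
  -- pass to the linear part.
  have hlin : ∀ z ∈ regularPolygon 4, a.linear z ∈ regularPolygon n := by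
    intro z hz
    have h1 := hin ⟨z, hz, rfl⟩
    have h2 := neg_mem_regularPolygon hn he (hin ⟨-z, hneg hz, rfl⟩)
    have h3 := (convex_regularPolygon n) h1 h2 (a := 1 / 2) (b := 1 / 2)
      (by norm_num) (by norm_num) (by norm_num)
    convert h3 using 1
    rw [hdecomp z, hdecomp (-z), map_neg]
    module
  have hcov : ∀ x ∈ regularPolygon n, ∃ c ∈ regularPolygon 4, x = r • a.linear c := by
    intro x hx
    obtain ⟨_, ⟨c, hc, rfl⟩, h1⟩ := hout hx
    obtain ⟨_, ⟨d, hd, rfl⟩, h2⟩ := hout (neg_mem_regularPolygon hn he hx)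
    refine ⟨_, (convex_regularPolygon 4) hc (hneg hd) (a := 1 / 2) (b := 1 / 2)
      (by norm_num) (by norm_num) (by norm_num), ?_⟩
    beta_reduce at h1 h2
    rw [hdecomp, smul_add] at h1 h2
    have h3 : x = (1 / 2 : ℝ) • x - (1 / 2 : ℝ) • (-x) := by module
    rw [h3, ← h2, ← h1]
    simp only [map_add, map_smul, map_neg]
    module
  set e : EuclideanSpace ℝ (Fin 2) := !₂[1, 0]
  set f : EuclideanSpace ℝ (Fin 2) := !₂[0, 1]
  have hu : a.linear e ∈ regularPolygon n :=
    hlin _ (mem_regularPolygon_four_iff.2 (by simp [e]))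
  have hv : a.linear f ∈ regularPolygon n :=
    hlin _ (mem_regularPolygon_four_iff.2 (by simp [f]))
  have hu0 : a.linear e ≠ 0 := by
    rw [Ne, LinearEquiv.map_eq_zero_iff]
    intro h
    simpa [e] using congrArg (fun z : EuclideanSpace ℝ (Fin 2) => z 0) h
  have hexp : ∀ c, a.linear c = c 0 • a.linear e + c 1 • a.linear f := by
    intro c
    rw [← map_smul, ← map_smul, ← map_add]
    congr 1
    ext i; fin_cases i <;> simp [e, f]
  generalize a.linear e = u at *
  generalize a.linear f = v at *
  have hbound : ∀ x ∈ regularPolygon n,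
      |planeCross (u - v) x| ≤ r * |planeCross u v| ∧
      |planeCross (u + v) x| ≤ r * |planeCross u v| := by
    intro x hx
    obtain ⟨c, hc, rfl⟩ := hcov x hx
    rw [hexp]
    obtain ⟨h1, h2⟩ := mem_regularPolygon_four_iff.1 hc
    have e1 : planeCross (u - v) (r • (c 0 • u + c 1 • v))
        = (c 0 + c 1) * (r * planeCross u v) := by simp [planeCross]; ring
    have e2 : planeCross (u + v) (r • (c 0 • u + c 1 • v))
        = -((c 0 - c 1) * (r * planeCross u v)) := by simp [planeCross]; ring
    have hpos : 0 ≤ |r * planeCross u v| := abs_nonneg _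
    rw [e1, e2, abs_neg, abs_mul, abs_mul (c 0 - c 1),
      show r * |planeCross u v| = |r * planeCross u v| by rw [abs_mul, abs_of_pos hr0]]
    exact ⟨mul_le_of_le_one_left hpos h1, mul_le_of_le_one_left hpos h2⟩
  -- Replacing v by -v flips the sign of the determinant and swaps u + v with u - v.
  rcases le_total 0 (planeCross u v) with hD | hD
  · refine ⟨u, hu, v, hv, hD, hu0, fun x hx => ?_, fun x hx => ?_⟩
    · simpa [abs_of_nonneg hD] using (le_abs_self _).trans (hbound x hx).1
    · simpa [abs_of_nonneg hD] using (le_abs_self _).trans (hbound x hx).2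
  · have hs : planeCross u (-v) = -planeCross u v := by simp [planeCross]; ring
    refine ⟨u, hu, -v, neg_mem_regularPolygon hn he hv, by linarith, hu0, fun x hx => ?_,
      fun x hx => ?_⟩
    · rw [hs, ← abs_of_nonpos hD, sub_neg_eq_add]
      exact (le_abs_self _).trans (hbound x hx).2
    · rw [hs, ← abs_of_nonpos hD, ← sub_eq_add_neg]
      exact (le_abs_self _).trans (hbound x hx).1

/-! ### Lower bound for n = 8j -/

theorem two_mul_planeCross_le (u v : EuclideanSpace ℝ (Fin 2)) :
    2 * planeCross u v ≤ (u 0 ^ 2 + u 1 ^ 2) + (v 0 ^ 2 + v 1 ^ 2) := by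
  unfold planeCross
  nlinarith [sq_nonneg (u 0 - v 1), sq_nonneg (u 1 + v 0)]

theorem sq_add_sq_pos_of_ne_zero {u : EuclideanSpace ℝ (Fin 2)} (hu : u ≠ 0) :
    0 < u 0 ^ 2 + u 1 ^ 2 := by
  by_contra! h
  apply hu
  ext i
  fin_cases i
  · simp; nlinarith [sq_nonneg (u 0), sq_nonneg (u 1)]
  · simp; nlinarith [sq_nonneg (u 0), sq_nonneg (u 1)]

/-- Rotation by `π / 4` about the origin. -/
noncomputable def rotateEighth : EuclideanSpace ℝ (Fin 2) →ₗ[ℝ] EuclideanSpace ℝ (Fin 2) where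
  toFun z := !₂[√2 / 2 * (z 0 - z 1), √2 / 2 * (z 0 + z 1)]
  map_add' y z := by
    ext i; fin_cases i <;> simp <;> ring
  map_smul' c z := by
    ext i; fin_cases i <;> simp <;> ring

theorem rotateEighth_mem {j : ℕ} (hj : j ≠ 0) {x : EuclideanSpace ℝ (Fin 2)}
    (hx : x ∈ regularPolygon (8 * j)) : rotateEighth x ∈ regularPolygon (8 * j) := by
  have hsub : regularPolygon (8 * j) ⊆ rotateEighth ⁻¹' regularPolygon (8 * j) := by
    refine regularPolygon_subset ((convex_regularPolygon _).linear_preimage _) fun k => ?_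
    have hv : rotateEighth (polygonVertex (8 * j) k) = polygonVertex (8 * j) (k + j) := by
      have ha : 2 * ((k + j : ℤ) : ℝ) / (8 * j : ℕ) * Real.pi
          = 2 * (k : ℝ) / (8 * j : ℕ) * Real.pi + Real.pi / 4 := by
        have : (j : ℝ) ≠ 0 := by exact_mod_cast hj
        push_cast
        field_simp
        ring
      ext i
      simp only [polygonVertex, ha, Real.cos_add, Real.sin_add, Real.cos_pi_div_four,
        Real.sin_pi_div_four]
      fin_cases i <;> simp [rotateEighth] <;> ring
    rw [Set.mem_preimage, hv]
    exact polygonVertex_mem (by omega) _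
  exact hsub hx

theorem sqrt_two_le_of_mem_bmRatios {j : ℕ} (hj : j ≠ 0) {r : ℝ}
    (hr : r ∈ bmRatios (regularPolygon 4) (regularPolygon (8 * j))) : √2 ≤ r := by
  obtain ⟨u, hu, v, hv, hD, hu0, hm, hp⟩ :=
    exists_columns_of_mem_bmRatios (by omega) ⟨4 * j, by ring⟩ hr
  have hu1 := rotateEighth_mem hj hu
  have hv1 := rotateEighth_mem hj hv
  have hu3 := rotateEighth_mem hj (rotateEighth_mem hj hu1)
  have hv3 := rotateEighth_mem hj (rotateEighth_mem hj hv1)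
  have hs : √2 * √2 = 2 := Real.mul_self_sqrt (by norm_num)
  have hs0 : 0 < √2 := by positivity
  -- With R the rotation by π/4, the test points R³u, Rv, Ru, -R³v are chosen so that the scalar
  -- products of u and v cancel in the sum.
  have a1 := hp _ hu3
  have a2 := hp _ hv1
  have a3 := hm _ hu1
  have a4 := hm _ (neg_mem_regularPolygon (by omega) ⟨4 * j, by ring⟩ hv3)
  have hsum : √2 * ((u 0 ^ 2 + u 1 ^ 2) + (v 0 ^ 2 + v 1 ^ 2)) + 2 * √2 * planeCross u v
      ≤ 4 * (r * planeCross u v) := by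
    calc _ = _ := ?_
      _ ≤ _ := add_le_add (add_le_add a1 a2) (add_le_add a3 a4)
      _ = _ := by ring
    · simp [planeCross, rotateEighth]
      have h3 : √2 ^ 3 = 2 * √2 := by rw [pow_succ, pow_two, hs]
      ring_nf
      rw [h3]
      ring
  have hN := sq_add_sq_pos_of_ne_zero hu0
  have hN' : 0 ≤ v 0 ^ 2 + v 1 ^ 2 := by positivity
  have hD' : 0 < planeCross u v := by
    refine lt_of_le_of_ne hD fun h => ?_
    rw [← h] at hsum
    have := mul_pos hs0 (add_pos_of_pos_of_nonneg hN hN')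
    linarith
  have hAM := mul_le_mul_of_nonneg_left (two_mul_planeCross_le u v) hs0.le
  have : √2 * planeCross u v ≤ r * planeCross u v := by linarith
  exact le_of_mul_le_mul_right this hD'

/-! ### Lower bound from the inscribed disc -/

/-- The support function of the regular `n`-gon is at least that of its inscribed disc. -/
theorem exists_planeCross_polygonVertex_ge {n : ℕ} (hn : 2 ≤ n)
    (w : EuclideanSpace ℝ (Fin 2)) :
    ∃ k : ℤ, Real.cos (Real.pi / n) * √(w 0 ^ 2 + w 1 ^ 2)
      ≤ planeCross w (polygonVertex n k) := by
  have hnR : (0 : ℝ) < n := by exact_mod_cast (by omega : 0 < n)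
  have hpi := Real.pi_pos
  -- z is w turned by π/2, so det(w, x) is the scalar product of z and x; some vertex direction is
  -- within π/n of that of z.
  set z : ℂ := ⟨-w 1, w 0⟩ with hz
  have hnorm : ‖z‖ = √(w 0 ^ 2 + w 1 ^ 2) := by
    rw [Complex.norm_def, Complex.normSq_apply]
    congr 1
    simp [hz]; ring
  have hre := Complex.norm_mul_cos_arg z
  have him := Complex.norm_mul_sin_arg z
  set θ := z.arg
  set k : ℤ := round (θ * n / (2 * Real.pi))
  have hk : |θ - 2 * (k : ℝ) / n * Real.pi| ≤ Real.pi / n := by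
    have h := abs_sub_round (θ * n / (2 * Real.pi))
    have e : θ - 2 * (k : ℝ) / n * Real.pi
        = (θ * n / (2 * Real.pi) - k) * (2 * Real.pi / n) := by field_simp
    rw [e, abs_mul, abs_of_pos (by positivity : 0 < 2 * Real.pi / n)]
    calc _ ≤ 1 / 2 * (2 * Real.pi / n) := by gcongr
      _ = _ := by ring
  refine ⟨k, ?_⟩
  have hcos : Real.cos (Real.pi / n) ≤ Real.cos (θ - 2 * (k : ℝ) / n * Real.pi) := by
    rw [← Real.cos_abs (θ - _)]
    exact Real.cos_le_cos_of_nonneg_of_le_pi (abs_nonneg _)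
      (div_le_self hpi.le (by exact_mod_cast (by omega : 1 ≤ n))) hk
  have heq : planeCross w (polygonVertex n k)
      = Real.cos (θ - 2 * (k : ℝ) / n * Real.pi) * ‖z‖ := by
    have h0 : w 0 = ‖z‖ * Real.sin θ := by rw [him]
    have h1 : w 1 = -(‖z‖ * Real.cos θ) := by rw [hre]; simp [hz]
    rw [Real.cos_sub]
    simp only [planeCross, polygonVertex, h0, h1, PiLp.toLp_apply, Matrix.cons_val_zero,
      Matrix.cons_val_one, Matrix.cons_val_fin_one]
    ring
  rw [heq, ← hnorm]
  gcongr

/-- Squaring the disc bound for u ± v and adding, the parallelogram law gives cos²(π/n)(|u|² + |v|²)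
≤ (rD)². Then 2D ≤ |u|² + |v|² and D ≤ 1 (u, v lie in the unit disc) finish. -/
theorem sqrt_two_mul_cos_le_of_mem_bmRatios {n : ℕ} (hn : 4 ≤ n) (he : Even n) {r : ℝ}
    (hr : r ∈ bmRatios (regularPolygon 4) (regularPolygon n)) :
    √2 * Real.cos (Real.pi / n) ≤ r := by
  obtain ⟨u, hu, v, hv, hD, hu0, hm, hp⟩ := exists_columns_of_mem_bmRatios (by omega) he hr
  have hr0 : 0 < r := hr.1
  have hc : 0 < Real.cos (Real.pi / n) := by
    have h2 : (2 : ℝ) < n := by exact_mod_cast (by omega : 2 < n)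
    apply Real.cos_pos_of_mem_Ioo
    constructor
    · have : 0 < Real.pi / n := by positivity
      linarith [Real.pi_pos]
    · exact div_lt_div_of_pos_left Real.pi_pos (by norm_num) h2
  set c := Real.cos (Real.pi / n)
  have hsq : ∀ w : EuclideanSpace ℝ (Fin 2),
      (∀ x ∈ regularPolygon n, planeCross w x ≤ r * planeCross u v) →
      c ^ 2 * (w 0 ^ 2 + w 1 ^ 2) ≤ (r * planeCross u v) ^ 2 := by
    intro w hw
    obtain ⟨k, hk⟩ := exists_planeCross_polygonVertex_ge (by omega : 2 ≤ n) w
    have h := hk.trans (hw _ (polygonVertex_mem (by omega) k))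
    have := pow_le_pow_left₀ (by positivity) h 2
    rwa [mul_pow, Real.sq_sqrt (by positivity)] at this
  have h1 := hsq _ hm
  have h2 := hsq _ hp
  simp only [PiLp.sub_apply, PiLp.add_apply] at h1 h2
  have hsum : c ^ 2 * ((u 0 ^ 2 + u 1 ^ 2) + (v 0 ^ 2 + v 1 ^ 2)) ≤ (r * planeCross u v) ^ 2 := by
    nlinarith
  have hN := sq_add_sq_pos_of_ne_zero hu0
  have hN' : 0 ≤ v 0 ^ 2 + v 1 ^ 2 := by positivity
  have hD' : 0 < planeCross u v := by
    refine lt_of_le_of_ne hD fun h => ?_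
    rw [← h] at hsum
    have := mul_pos (pow_pos hc 2) (add_pos_of_pos_of_nonneg hN hN')
    nlinarith
  have hAM := two_mul_planeCross_le u v
  have hD1 : planeCross u v ≤ 1 := by
    linarith [sq_add_sq_le_one_of_mem_regularPolygon hu, sq_add_sq_le_one_of_mem_regularPolygon hv]
  have hfin : 2 * c ^ 2 ≤ r ^ 2 * planeCross u v := by
    refine le_of_mul_le_mul_right ?_ hD'
    have := mul_le_mul_of_nonneg_left hAM (sq_nonneg c)
    nlinarith
  have hfin' : 2 * c ^ 2 ≤ r ^ 2 := hfin.trans (mul_le_of_le_one_right (sq_nonneg r) hD1)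
  refine (sq_le_sq₀ (by positivity) hr0.le).1 ?_
  rwa [mul_pow, Real.sq_sqrt (by norm_num)]

/-! ### Upper bounds when 4 divides n -/

theorem sin_pi_div_le_abs_sin {n : ℕ} {q : ℤ} (hq : ¬ (n : ℤ) ∣ q) (hn : n ≠ 0) :
    Real.sin (Real.pi / n) ≤ |Real.sin (q * Real.pi / n)| := by
  have hn' : (n : ℤ) ≠ 0 := by exact_mod_cast hn
  have hnR : (0 : ℝ) < n := by exact_mod_cast Nat.pos_of_ne_zero hn
  have h0 := Int.emod_nonneg q hn'
  have h1 : q % n < n := Int.emod_lt_of_pos q (by positivity)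
  have h2 : q % n ≠ 0 := fun h => hq (Int.dvd_of_emod_eq_zero h)
  have hk : (q : ℝ) = ((q % n : ℤ) : ℝ) + n * ((q / n : ℤ) : ℝ) := by
    exact_mod_cast (Int.emod_add_mul_ediv q n).symm
  have ha : (q : ℝ) * Real.pi / n
      = ((q % n : ℤ) : ℝ) * Real.pi / n + ((q / n : ℤ) : ℝ) * Real.pi := by
    rw [hk]; field_simp
  have hs1 : (1 : ℝ) ≤ ((q % n : ℤ) : ℝ) := by exact_mod_cast (by omega : 1 ≤ q % n)
  have hs2 : ((q % n : ℤ) : ℝ) + 1 ≤ n := by exact_mod_cast (by omega : q % n + 1 ≤ n)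
  rw [ha, Real.sin_add_int_mul_pi, abs_mul, abs_zpow, abs_neg, abs_one, one_zpow, one_mul]
  set s : ℝ := ((q % n : ℤ) : ℝ)
  refine le_trans ?_ (le_abs_self _)
  rw [← sub_nonneg, Real.sin_sub_sin]
  have hpi := Real.pi_pos
  apply mul_nonneg
  · apply mul_nonneg zero_le_two
    apply Real.sin_nonneg_of_nonneg_of_le_pi
    · rw [← sub_div]
      have : 0 ≤ s * Real.pi - Real.pi := by nlinarith
      positivity
    · rw [← sub_div, div_div, div_le_iff₀ (by positivity)]
      nlinarith
  · apply Real.cos_nonneg_of_neg_pi_div_two_le_of_le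
    · have : 0 ≤ (s * Real.pi / n + Real.pi / n) / 2 := by positivity
      linarith
    · rw [← add_div, div_div, div_le_iff₀ (by positivity)]
      nlinarith

theorem abs_cos_odd_le {n : ℕ} (hn : 2 ≤ n) (he : Even n) {q : ℤ} (hq : Odd q) :
    |Real.cos (q * Real.pi / n)| ≤ Real.cos (Real.pi / n) := by
  have hd : ¬ (n : ℤ) ∣ q := by
    intro h
    obtain ⟨m, rfl⟩ := he
    obtain ⟨c, hc⟩ := h
    obtain ⟨d, rfl⟩ := hq
    push_cast at hc
    have : (2 : ℤ) ∣ 1 := ⟨m * c - d, by linear_combination hc⟩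
    omega
  have h := sin_pi_div_le_abs_sin hd (by omega)
  have hn2 : (2 : ℝ) ≤ n := by exact_mod_cast hn
  have hpi := Real.pi_pos
  have hle : Real.pi / n ≤ Real.pi / 2 := div_le_div_of_nonneg_left hpi.le (by norm_num) hn2
  have hge : 0 ≤ Real.pi / n := by positivity
  have hs : 0 ≤ Real.sin (Real.pi / n) :=
    Real.sin_nonneg_of_nonneg_of_le_pi hge (by linarith)
  have hc : 0 ≤ Real.cos (Real.pi / n) :=
    Real.cos_nonneg_of_neg_pi_div_two_le_of_le (by linarith) hle
  apply abs_le_of_sq_le_sq _ hc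
  rw [Real.cos_sq', Real.cos_sq', ← sq_abs (Real.sin (q * Real.pi / n))]
  have := pow_le_pow_left₀ hs h 2
  linarith

theorem unit_vectors_mem_regularPolygon {m : ℕ} (hm : m ≠ 0) :
    !₂[1, 0] ∈ regularPolygon (4 * m) ∧ !₂[0, 1] ∈ regularPolygon (4 * m) := by
  have hmR : (m : ℝ) ≠ 0 := by exact_mod_cast hm
  constructor
  · convert polygonVertex_mem (by omega : 4 * m ≠ 0) 0 using 1
    simp [polygonVertex]
  · convert polygonVertex_mem (by omega : 4 * m ≠ 0) (m : ℤ) using 1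
    have : 2 * ((m : ℤ) : ℝ) / ((4 * m : ℕ) : ℝ) * Real.pi = Real.pi / 2 := by
      push_cast; field_simp; norm_num
    simp only [polygonVertex, this, Real.cos_pi_div_two, Real.sin_pi_div_two]

/-- The angle in `h` is that of vertex k measured from π/4, the normal direction of a side of the
square. -/
theorem bmDist_four_le_of_forall_abs_cos_le {m : ℕ} (hm : m ≠ 0) {c : ℝ} (hc : 0 < c)
    (h : ∀ k : ℤ, |Real.cos ((2 * k - m) * Real.pi / (4 * m : ℕ))| ≤ c) :
    bmDist (regularPolygon 4) (regularPolygon (4 * m)) ≤ ((√2 * c : ℝ) : EReal) := by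
  have hmR : (m : ℝ) ≠ 0 := by exact_mod_cast hm
  obtain ⟨h0, h1⟩ := unit_vectors_mem_regularPolygon hm
  have hs : √2 * √2 = 2 := Real.mul_self_sqrt (by norm_num)
  have hadd : ∀ k : ℤ, |Real.cos (2 * k / (4 * m : ℕ) * Real.pi)
      + Real.sin (2 * k / (4 * m : ℕ) * Real.pi)| ≤ √2 * c := by
    intro k
    have e : ((2 * k - m) * Real.pi / (4 * m : ℕ) : ℝ)
        = 2 * k / (4 * m : ℕ) * Real.pi - Real.pi / 4 := by
      push_cast; field_simp
    have hk := h k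
    rw [e, Real.cos_sub, Real.cos_pi_div_four, Real.sin_pi_div_four] at hk
    set x := Real.cos (2 * k / (4 * m : ℕ) * Real.pi)
    set y := Real.sin (2 * k / (4 * m : ℕ) * Real.pi)
    have e2 : x + y = √2 * (x * (√2 / 2) + y * (√2 / 2)) := by
      linear_combination (-(x + y) / 2) * hs
    rw [e2, abs_mul, abs_of_nonneg (Real.sqrt_nonneg 2)]
    gcongr
  have hsub : ∀ k : ℤ, |Real.cos (2 * k / (4 * m : ℕ) * Real.pi)
      - Real.sin (2 * k / (4 * m : ℕ) * Real.pi)| ≤ √2 * c := by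
    intro k
    have hk := hadd (-k)
    have e : (2 * ((-k : ℤ) : ℝ) / (4 * m : ℕ) * Real.pi)
        = -(2 * k / (4 * m : ℕ) * Real.pi) := by push_cast; ring
    rwa [e, Real.cos_neg, Real.sin_neg, ← sub_eq_add_neg] at hk
  refine bmDist_four_le (by omega) ⟨2 * m, by ring⟩ (by positivity) h0 h1
    (by simp [planeCross]) (fun k => ?_) (fun k => ?_)
  · have := hadd k
    simp only [planeCross, polygonVertex, PiLp.sub_apply, PiLp.toLp_apply, Matrix.cons_val_zero,
      Matrix.cons_val_one, Matrix.cons_val_fin_one]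
    ring_nf at this ⊢
    exact this
  · have := hsub k
    rw [← abs_neg] at this
    simp only [planeCross, polygonVertex, PiLp.add_apply, PiLp.toLp_apply, Matrix.cons_val_zero,
      Matrix.cons_val_one, Matrix.cons_val_fin_one]
    ring_nf at this ⊢
    exact this

/-! ### Upper bound when n ≡ 2 mod 4 -/

/-- The inner parallelogram is the rectangle with vertices `(±1, ±sin 2φ) / r`, where `r` is the
bound; its vertices lie on edges of the polygon. -/
theorem bmDist_four_le_of_angle {m : ℕ} {p q : ℤ} {φ : ℝ} (h0 : 0 < φ) (h1 : φ < Real.pi / 2)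
    (hp : φ = 2 * p / (4 * m + 2 : ℕ) * Real.pi)
    (hq : Real.pi - 3 * φ = 2 * q / (4 * m + 2 : ℕ) * Real.pi)
    (hs : Real.sin (2 * φ) = Real.cos (Real.pi / (4 * m + 2 : ℕ))) :
    bmDist (regularPolygon 4) (regularPolygon (4 * m + 2)) ≤
      ((1 / 2 * (1 / Real.cos φ) + Real.cos φ : ℝ) : EReal) := by
  have hn : 4 * m + 2 ≠ 0 := by omega
  have hcpos : 0 < Real.cos φ := Real.cos_pos_of_mem_Ioo ⟨by linarith, h1⟩
  have hspos : 0 < Real.sin φ := Real.sin_pos_of_pos_of_lt_pi h0 (by linarith)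
  have hsin3 : Real.sin (3 * φ) = Real.sin φ * (4 * Real.cos φ ^ 2 - 1) := by
    rw [Real.sin_three_mul]
    linear_combination (-4 * Real.sin φ) * Real.sin_sq_add_cos_sq φ
  have hcos3 := Real.cos_three_mul φ
  have vp : polygonVertex (4 * m + 2) p = !₂[Real.cos φ, Real.sin φ] := by
    simp only [polygonVertex, ← hp]
  have vp' : polygonVertex (4 * m + 2) (-p) = !₂[Real.cos φ, -Real.sin φ] := by
    have : 2 * ((-p : ℤ) : ℝ) / (4 * m + 2 : ℕ) * Real.pi = -φ := by rw [hp]; push_cast; ring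
    simp only [polygonVertex, this, Real.cos_neg, Real.sin_neg]
  have vq : polygonVertex (4 * m + 2) q = !₂[-Real.cos (3 * φ), Real.sin (3 * φ)] := by
    simp only [polygonVertex, ← hq, Real.cos_pi_sub, Real.sin_pi_sub]
  have vq' : polygonVertex (4 * m + 2) (-q) = !₂[-Real.cos (3 * φ), -Real.sin (3 * φ)] := by
    have : 2 * ((-q : ℤ) : ℝ) / (4 * m + 2 : ℕ) * Real.pi = -(Real.pi - 3 * φ) := by
      rw [hq]; push_cast; ring
    simp only [polygonVertex, this, Real.cos_neg, Real.sin_neg, Real.cos_pi_sub, Real.sin_pi_sub]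
  have mp := vp ▸ polygonVertex_mem hn p
  have mp' := vp' ▸ polygonVertex_mem hn (-p)
  have mq := vq ▸ polygonVertex_mem hn q
  have mq' := vq' ▸ polygonVertex_mem hn (-q)
  -- Since n/2 is odd, each vertex height is the cosine of an odd multiple of π/n, hence at most
  -- cos(π/n) = sin 2φ in absolute value.
  have hsb : ∀ k : ℤ, |Real.sin (2 * k / (4 * m + 2 : ℕ) * Real.pi)|
      ≤ 2 * Real.sin φ * Real.cos φ := by
    intro k
    have hodd : Odd (2 * m + 1 - 2 * k : ℤ) := ⟨m - k, by ring⟩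
    have hb := abs_cos_odd_le (by omega : 2 ≤ 4 * m + 2) ⟨2 * m + 1, by ring⟩ hodd
    have e : ((2 * m + 1 - 2 * k : ℤ) : ℝ) * Real.pi / (4 * m + 2 : ℕ)
        = Real.pi / 2 - 2 * k / (4 * m + 2 : ℕ) * Real.pi := by
      have : (4 * m + 2 : ℝ) ≠ 0 := by positivity
      push_cast; field_simp; ring
    rwa [e, Real.cos_pi_div_two_sub, ← hs, Real.sin_two_mul] at hb
  have hcb : ∀ k : ℤ, |Real.cos (2 * k / (4 * m + 2 : ℕ) * Real.pi)| ≤ 1 :=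
    fun k => Real.abs_cos_le_one _
  set C := Real.cos φ
  set S := Real.sin φ
  have hden : 0 < 2 * C ^ 2 + 1 := by positivity
  have hr : 1 / 2 * (1 / C) + C = (2 * C ^ 2 + 1) / (2 * C) := by field_simp; ring
  set a : ℝ := 2 * C / (2 * C ^ 2 + 1)
  set b : ℝ := 2 * S * C * a
  have ha0 : 0 < a := by positivity
  have hb0 : 0 < b := by positivity
  have hra : (1 / 2 * (1 / C) + C) * a = 1 := by rw [hr]; simp only [a]; field_simp
  -- The ray through (1, sin 2φ) meets the segment from the vertex at angle φ to the one at π - 3φ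
  -- at parameter t.
  set t : ℝ := 1 / (2 * (2 * C ^ 2 + 1)) with ht
  have ht0 : 0 ≤ t := by positivity
  have ht1 : 0 ≤ 1 - t := by
    rw [sub_nonneg, ht, div_le_one (by positivity)]; nlinarith [sq_nonneg C]
  have hx : (1 - t) * C + t * -Real.cos (3 * φ) = a := by
    rw [hcos3]; simp only [t, a]; field_simp; ring
  have hy : (1 - t) * S + t * Real.sin (3 * φ) = b := by
    rw [hsin3]; simp only [t, a, b]; field_simp; ring
  have hu : !₂[a, b] ∈ regularPolygon (4 * m + 2) := by
    convert convex_regularPolygon _ mp mq ht1 ht0 (by ring) using 1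
    ext i
    fin_cases i
    · simpa using hx.symm
    · simpa using hy.symm
  have hv : !₂[a, -b] ∈ regularPolygon (4 * m + 2) := by
    convert convex_regularPolygon _ mp' mq' ht1 ht0 (by ring) using 1
    ext i
    fin_cases i
    · simpa using hx.symm
    · simp only [Fin.mk_one, PiLp.add_apply, PiLp.smul_apply, smul_eq_mul,
        Matrix.cons_val_one, Matrix.cons_val_fin_one]
      linear_combination hy
  have hcr : planeCross !₂[a, -b] !₂[a, b] = 2 * a * b := by simp [planeCross]; ring
  refine bmDist_four_le hn ⟨2 * m + 1, by ring⟩ (by positivity) hv hu ?_ (fun k => ?_)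
    (fun k => ?_)
  · rw [hcr]; positivity
  · have e : planeCross (!₂[a, -b] - !₂[a, b]) (polygonVertex (4 * m + 2) k)
        = 2 * b * Real.cos (2 * k / (4 * m + 2 : ℕ) * Real.pi) := by
      simp [planeCross, polygonVertex]; ring
    rw [e, hcr, abs_mul, abs_of_pos (by positivity : 0 < 2 * b)]
    calc _ ≤ 2 * b * 1 := by gcongr; exact hcb k
      _ = _ := by linear_combination (-2 * b) * hra
  · have e : planeCross (!₂[a, -b] + !₂[a, b]) (polygonVertex (4 * m + 2) k)
        = 2 * a * Real.sin (2 * k / (4 * m + 2 : ℕ) * Real.pi) := by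
      simp only [planeCross, polygonVertex, PiLp.add_apply, PiLp.toLp_apply,
        Matrix.cons_val_zero, Matrix.cons_val_one, Matrix.cons_val_fin_one]
      ring
    rw [e, hcr, abs_mul, abs_of_pos (by positivity : 0 < 2 * a)]
    calc _ ≤ 2 * a * (2 * S * C) := by gcongr; exact hsb k
      _ = _ := by simp only [b]; linear_combination (-4 * S * C * a) * hra

/-! ### The four families -/

theorem theorem2 :
    (∀ j : ℕ, 1 ≤ j →
      bmDist (regularPolygon 4) (regularPolygon (8 * j)) = ((Real.sqrt 2 : ℝ) : EReal)) ∧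
    (∀ j : ℕ, 1 ≤ j →
      bmDist (regularPolygon 4) (regularPolygon (8 * j + 2)) ≤
        ((1 / 2 * (1 / Real.cos (2 * (j : ℝ) / (8 * (j : ℝ) + 2) * Real.pi)) +
          Real.cos (2 * (j : ℝ) / (8 * (j : ℝ) + 2) * Real.pi) : ℝ) : EReal)) ∧
    (∀ j : ℕ,
      bmDist (regularPolygon 4) (regularPolygon (8 * j + 4)) =
        ((Real.sqrt 2 * Real.cos (1 / (8 * (j : ℝ) + 4) * Real.pi) : ℝ) : EReal)) ∧
    (∀ j : ℕ,
      bmDist (regularPolygon 4) (regularPolygon (8 * j + 6)) ≤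
        ((Real.sin ((2 * (j : ℝ) + 2) / (8 * (j : ℝ) + 6) * Real.pi) *
            (1 / Real.sin ((4 * (j : ℝ) + 2) / (8 * (j : ℝ) + 6) * Real.pi)) +
          Real.cos ((2 * (j : ℝ) + 2) / (8 * (j : ℝ) + 6) * Real.pi) : ℝ) : EReal)) := by
  have hpi := Real.pi_pos
  refine ⟨fun j hj => le_antisymm ?_ ?_, fun j hj => ?_, fun j => le_antisymm ?_ ?_, fun j => ?_⟩
  · have h := bmDist_four_le_of_forall_abs_cos_le (m := 2 * j) (by omega) one_pos
      fun k => Real.abs_cos_le_one _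
    rwa [← mul_assoc, mul_one] at h
  · exact le_iInf₂ fun r hr => EReal.coe_le_coe_iff.2
      (sqrt_two_le_of_mem_bmRatios (by omega) hr)
  · have hj0 : (0 : ℝ) < j := by exact_mod_cast hj
    have hd : (8 * j + 2 : ℝ) ≠ 0 := by positivity
    -- Here 2φ = π/2 - π/n.
    have h := bmDist_four_le_of_angle (m := 2 * j) (p := j) (q := j + 1)
      (φ := 2 * (j : ℝ) / (8 * (j : ℝ) + 2) * Real.pi) (by positivity) ?_ ?_ ?_ ?_
    · convert h using 3; ring
    · rw [div_mul_eq_mul_div, div_lt_div_iff₀ (by positivity) (by norm_num)]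
      nlinarith
    · push_cast; ring
    · push_cast; field_simp; ring
    · rw [← Real.cos_pi_div_two_sub]
      congr 1
      push_cast; field_simp; ring
  · have h := bmDist_four_le_of_forall_abs_cos_le (m := 2 * j + 1) (by omega)
      (c := Real.cos (1 / (8 * (j : ℝ) + 4) * Real.pi)) ?_ ?_
    · rwa [show 4 * (2 * j + 1) = 8 * j + 4 by ring] at h
    · apply Real.cos_pos_of_mem_Ioo
      constructor
      · have : 0 < 1 / (8 * (j : ℝ) + 4) * Real.pi := by positivity
        linarith
      · rw [div_mul_eq_mul_div, div_lt_div_iff₀ (by positivity) (by norm_num)]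
        nlinarith [(Nat.cast_nonneg j : (0 : ℝ) ≤ j)]
    · intro k
      have hodd : Odd (2 * k - (2 * j + 1) : ℤ) := ⟨k - j - 1, by ring⟩
      have hb := abs_cos_odd_le (n := 4 * (2 * j + 1)) (by omega) ⟨2 * (2 * j + 1), by ring⟩ hodd
      have e : 1 / (8 * (j : ℝ) + 4) * Real.pi = Real.pi / (4 * (2 * j + 1) : ℕ) := by
        push_cast; field_simp; ring
      rw [e]
      convert hb using 4
      push_cast; ring
  · refine le_iInf₂ fun r hr => EReal.coe_le_coe_iff.2 ?_
    convert sqrt_two_mul_cos_le_of_mem_bmRatios (by omega) ⟨4 * j + 2, by ring⟩ hr using 3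
    push_cast; ring
  · have hj0 : (0 : ℝ) ≤ j := Nat.cast_nonneg j
    have hd : (8 * j + 6 : ℝ) ≠ 0 := by positivity
    set φ := (2 * (j : ℝ) + 2) / (8 * (j : ℝ) + 6) * Real.pi with hφ
    have h1 : φ < Real.pi / 2 := by
      rw [hφ, div_mul_eq_mul_div, div_lt_div_iff₀ (by positivity) (by norm_num)]
      nlinarith
    have h0 : 0 < φ := by positivity
    -- Here 2φ = π/2 + π/n, and the cosecant in (IV) is 1 / sin 2φ.
    have h := bmDist_four_le_of_angle (m := 2 * j + 1) (p := j + 1) (q := j) h0 h1 ?_ ?_ ?_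
    · have hω : (4 * (j : ℝ) + 2) / (8 * (j : ℝ) + 6) * Real.pi = Real.pi - 2 * φ := by
        rw [hφ]; field_simp; ring
      have hc : 0 < Real.cos φ := Real.cos_pos_of_mem_Ioo ⟨by linarith, h1⟩
      have hs : 0 < Real.sin φ := Real.sin_pos_of_pos_of_lt_pi h0 (by linarith)
      rw [hω, Real.sin_pi_sub, Real.sin_two_mul]
      have e : Real.sin φ * (1 / (2 * Real.sin φ * Real.cos φ)) = 1 / 2 * (1 / Real.cos φ) := by
        field_simp
      rw [e]
      rwa [show 4 * (2 * j + 1) + 2 = 8 * j + 6 by ring] at h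
    · rw [hφ]; push_cast; ring
    · rw [hφ]; push_cast; field_simp; ring
    · rw [← Real.cos_sub_pi_div_two, hφ]
      congr 1
      push_cast; field_simp; ring
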